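/- Let $G$ be a finite connected weighted multigraph (loops and multiple edges allowed) with vertex set $V$, $|V|=n>1$, and edge weights $w_\varepsilon>0$. Let $A=(a_{ij})$ be its weighted adjacency matrix: $a_{ij}$ is the total weight of the $(i,j)$ edges (a loop at $i$ contributes its weight once to $a_{ii}$). Let $n_{ij}$ be the number of $(i,j)$ edges and $N=(n_{ij})$. Let $\rho$ be the spectral radius of $A$, $\Lambda=\rho I-A$, and let $p=(p_i)_{i\in V}$ be the Perron vector of $A$, i.e. the unique probability vector with $Ap=\rho p$; all $p_i$ are positive. For $\alpha>0$ replace every edge weight $w$ by $w(\alpha)=\frac{w}{\rho}e^{-1/(\alpha w)}$ and let $A(\alpha)$ be the weighted adjacency matrix of the resulting graph. The series $\tilde R_\alpha=(\tilde r_{ij}(\alpha))=\sum_{k\ge0}A(\alpha)^k$ converges and has positive entries for every $\alpha>0$. Let $\theta_\alpha>0$ $(\alpha>0)$ be scaling factors with $\lim_{\alpha\to0^+}\theta_\alpha=1$ and $\lim_{\alpha\to\infty}\theta_\alpha=\theta_\infty\in\mathbb R$. With $\tilde h_{ij}(\alpha)=\theta_\alpha\,\alpha\ln\tilde r_{ij}(\alpha)$,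 the $e$-walk distances are $$d^{e}_\alpha(i,j)=\tfrac12\bigl(\tilde h_{ii}(\alpha)+\tilde h_{jj}(\alpha)\bigr)-\tilde h_{ij}(\alpha),\qquad i,j\in V.$$ The weighted shortest path distance is $d^{ws}(i,j)=\min_\pi\sum_{\varepsilon\in E(\pi)}1/w_\varepsilon$, the minimum being over all paths $\pi$ from $i$ to $j$; it is attained. For a matrix $M$ and $j\in V$, let $M_{jj}$ be $M$ with row and column $j$ removed and $M_{\setminus j}$ be $M$ with row $j$ removed; rows remain indexed by vertices. All the matrices $\Lambda_{jj}$ are invertible. Then for all vertices $i\ne j$: 1. $\displaystyle\lim_{\alpha\to0^+}d^{e}_\alpha(i,j)=d^{ws}(i,j)$; 2. $\displaystyle\lim_{\alpha\to\infty}d^{e}_\alpha(i,j)=\frac{\theta_\infty}{2}\Bigl(p_i^{-1}\bigl((\Lambda_{jj})^{-1}N_{\setminus j}\bigr)_i+p_j^{-1}\bigl((\Lambda_{ii})^{-1}N_{\setminus i}\bigr)_j\Bigr)p$, where $(\cdot)_i$ denotes the row of vertex $i$. In particular, if $G$ has no two edges with the same ends (loops being allowed, at most one at each vertex), then $$\lim_{\alpha\to\infty}d^{e}_\alpha(i,j)=\frac{\theta_\infty}{2}\Bigl(p_i^{-1}\bigl((\Lambda_{jj})^{-1}\check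 A_{\setminus j}\bigr)_i+p_j^{-1}\bigl((\Lambda_{ii})^{-1}\check A_{\setminus i}\bigr)_j\Bigr)p,$$ where $\check A$ is obtained from $A$ by replacing every nonzero entry by $1$. -/

import Mathlib

open Filter Topology Matrix
open scoped Graph

namespace Graph

/-- A `v₀ → vₘ` walk in a multigraph: an arbitrary alternating sequence of vertices and edges
`v₀, ε₁, v₁, …, εₘ, vₘ` in which each `εᵢ` is a `(vᵢ₋₁, vᵢ)` edge. -/
inductive EdgeWalk {α β : Type*} (G : Graph α β) : α → α → Type _
  | nil (x : α) (hx : x ∈ V(G)) : EdgeWalk G x x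
  | cons {x y z : α} (e : β) (h : G.IsLink e x y) (π : EdgeWalk G y z) : EdgeWalk G x z

namespace EdgeWalk

/-- The vertices of a walk, in order. -/
def verts {α β : Type*} {G : Graph α β} : {x y : α} → EdgeWalk G x y → List α
  | _, _, nil x _ => [x]
  | x, _, cons _ _ π => x :: π.verts

/-- The edges of a walk, in order. -/
def edges {α β : Type*} {G : Graph α β} : {x y : α} → EdgeWalk G x y → List β
  | _, _, nil _ _ => []
  | _, _, cons e _ π => e :: π.edges

/-- A (simple) path is a walk whose vertices are all distinct. -/
def IsSimplePath {α β : Type*} {G : Graph α β} {x y : α} (π : EdgeWalk G x y) : Prop :=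
  π.verts.Nodup

/-- The weighted length `∑_{ε ∈ E(π)} 1 / w_ε`. -/
noncomputable def weightedLength {α β : Type*} {G : Graph α β} (w : β → ℝ) {x y : α}
    (π : EdgeWalk G x y) : ℝ :=
  (π.edges.map fun e => 1 / w e).sum

end EdgeWalk

/-- Every two vertices are joined by a walk. -/
def WalkConnected {α β : Type*} (G : Graph α β) : Prop :=
  ∀ i j : V(G), Nonempty (EdgeWalk G (i : α) (j : α))

/-- There is at most one edge between any two vertices, and at most one loop at any vertex. -/
def NoParallelEdges {α β : Type*} (G : Graph α β) : Prop :=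
  ∀ (e f : β) (x y : α), G.IsLink e x y → G.IsLink f x y → e = f

/-- The set of the weighted lengths of all paths from `i` to `j`. -/
def pathLengths {α β : Type*} (G : Graph α β) (w : β → ℝ) (i j : V(G)) : Set ℝ :=
  {l | ∃ π : EdgeWalk G (i : α) (j : α), π.IsSimplePath ∧ π.weightedLength w = l}

/-- The weighted shortest path distance `d^ws`: the least weighted length of a path. -/
noncomputable def weightedShortestPathDist {α β : Type*} (G : Graph α β) (w : β → ℝ)
    (i j : V(G)) : ℝ :=
  sInf (G.pathLengths w i j)

open Classical in
/-- The weighted adjacency matrix: the `(i, j)` entry is the total weight of the `(i, j)` edges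
(a loop at `i` is counted once in the entry `(i, i)`). -/
noncomputable def weightedAdj {α β : Type*} (G : Graph α β) [Fintype E(G)] (w : β → ℝ) :
    Matrix V(G) V(G) ℝ :=
  Matrix.of fun i j => ∑ e : E(G), if G.IsLink (e : β) (i : α) (j : α) then w e else 0

open Classical in
/-- The multiplicity matrix: the `(i, j)` entry is the number of the `(i, j)` edges. -/
noncomputable def multiplicityMatrix {α β : Type*} (G : Graph α β) [Fintype E(G)] :
    Matrix V(G) V(G) ℝ :=
  Matrix.of fun i j =>
    ((Finset.univ.filter fun e : E(G) => G.IsLink (e : β) (i : α) (j : α)).card : ℝ)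

open Classical in
/-- The matrix obtained from `A` by replacing every nonzero entry by `1`. -/
noncomputable def supportMatrix {ι : Type*} (A : Matrix ι ι ℝ) : Matrix ι ι ℝ :=
  Matrix.of fun i j => if A i j = 0 then 0 else 1

/-- The spectral radius `ρ(A)` of a symmetric real matrix `A` (all its eigenvalues are real). -/
noncomputable def perronRoot {ι : Type*} [Fintype ι] [DecidableEq ι] (A : Matrix ι ι ℝ) : ℝ :=
  (spectralRadius ℝ A).toReal

/-- `p` is a probability vector that is an eigenvector of `A` associated with `ρ(A)`. -/
def IsPerronVector {ι : Type*} [Fintype ι] [DecidableEq ι] (A : Matrix ι ι ℝ) (p : ι → ℝ) : Prop :=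
  A *ᵥ p = perronRoot A • p ∧ (∀ i, 0 ≤ p i) ∧ ∑ i, p i = 1

/-- The matrix `Λ = ρ I - A`. -/
noncomputable def paraLaplacian {ι : Type*} [Fintype ι] [DecidableEq ι] (A : Matrix ι ι ℝ) :
    Matrix ι ι ℝ :=
  perronRoot A • (1 : Matrix ι ι ℝ) - A

/-- `M` with row `j` and column `j` removed. -/
def removeRowCol {ι : Type*} (M : Matrix ι ι ℝ) (j : ι) : Matrix {k // k ≠ j} {k // k ≠ j} ℝ :=
  M.submatrix Subtype.val Subtype.val

/-- `M` with row `j` removed. -/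
def removeRow {ι : Type*} (M : Matrix ι ι ℝ) (j : ι) : Matrix {k // k ≠ j} ι ℝ :=
  M.submatrix Subtype.val id

/-- The transformed edge weights `w(α) = (w / ρ) exp (-1 / (α w))`, where `ρ` is the Perron root of
the weighted adjacency matrix of `G`. -/
noncomputable def eWeight {α β : Type*} [DecidableEq α] (G : Graph α β) [Fintype V(G)]
    [Fintype E(G)] (w : β → ℝ) (a : ℝ) (e : β) : ℝ :=
  w e / perronRoot (G.weightedAdj w) * Real.exp (-(1 / (a * w e)))

/-- The weighted adjacency matrix `A(α)` of the transformed graph. -/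
noncomputable def eAdj {α β : Type*} [DecidableEq α] (G : Graph α β) [Fintype V(G)]
    [Fintype E(G)] (w : β → ℝ) (a : ℝ) : Matrix V(G) V(G) ℝ :=
  G.weightedAdj (G.eWeight w a)

/-- The matrix of walk weights `∑_{k ≥ 0} A(α)^k` of the transformed graph. -/
noncomputable def eWalkWeights {α β : Type*} [DecidableEq α] (G : Graph α β) [Fintype V(G)]
    [Fintype E(G)] (w : β → ℝ) (a : ℝ) : Matrix V(G) V(G) ℝ :=
  ∑' k : ℕ, G.eAdj w a ^ k

/-- The entries `θ_α α ln r_ij(α)`. -/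
noncomputable def eLogWeights {α β : Type*} [DecidableEq α] (G : Graph α β) [Fintype V(G)]
    [Fintype E(G)] (w : β → ℝ) (θ : ℝ → ℝ) (a : ℝ) : Matrix V(G) V(G) ℝ :=
  Matrix.of fun i j => θ a * a * Real.log (G.eWalkWeights w a i j)

/-- The e-walk distance with parameter `α` and scaling factor `θ_α`. -/
noncomputable def eWalkDist {α β : Type*} [DecidableEq α] (G : Graph α β) [Fintype V(G)]
    [Fintype E(G)] (w : β → ℝ) (θ : ℝ → ℝ) (a : ℝ) (i j : V(G)) : ℝ :=
  1 / 2 * (G.eLogWeights w θ a i i + G.eLogWeights w θ a j j) - G.eLogWeights w θ a i j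

/-- The number `(θ_∞ / 2) (p_i⁻¹ ((Λ_jj)⁻¹ C_j)_i + p_j⁻¹ ((Λ_ii)⁻¹ C_i)_j) p`, where `Λ = ρ I - A`,
`Λ_jj` is `Λ` without row and column `j`, and `C_j` is `C` without row `j`. -/
noncomputable def longEWalkValue {ι : Type*} [Fintype ι] [DecidableEq ι] (A C : Matrix ι ι ℝ)
    (p : ι → ℝ) (θinf : ℝ) (i j : ι) (hij : i ≠ j) : ℝ :=
  θinf / 2 *
    (((p i)⁻¹ • ((removeRowCol (paraLaplacian A) j)⁻¹ * removeRow C j) ⟨i, hij⟩ +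
      (p j)⁻¹ • ((removeRowCol (paraLaplacian A) i)⁻¹ * removeRow C i) ⟨j, hij.symm⟩) ⬝ᵥ p)

end Graph

/-! For small `α`, the series `∑ A(α)^k` sums over walks `π` terms of the form `c_π exp(-L(π)/α)`,
with `L` the weighted length, so the shortest walks dominate and `α ln r̃_ij` tends to `-d^ws(i,j)`.
The lower bound keeps one shortest path (`exists_le_eWalkWeights`). The upper bound compares with
the convergent series at `α = 1`, every walk losing at least the factor `exp(-(1/α - 1) d^ws(i,j))`
(`eWalkWeights_le`).

For large `α`, symmetry of `R̃` gives `d^e = -(θ/2)(α ln(r̃_ij/r̃_jj) + α ln(r̃_ji/r̃_ii))`. Away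
from row `j`, column `j` of `R̃` is annihilated by `I - A(α)`, so the ratios `r̃_kj/r̃_jj` solve a
linear system with matrix `(I - A(α))_jj`. This stays invertible in the limit because the Perron
root is simple (`isUnit_det_removeRowCol_paraLaplacian`). Since `w exp(-1/(αw)) = w - 1/α + o(1/α)`,
every edge contributes the same correction and `A(α) = ρ⁻¹(A - N/α) + o(1/α)`. Hence the ratios
equal `p_k/p_j` plus an explicit term of order `1/α` (`tendsto_mul_div_sub`). After taking
logarithms, the leading terms `ln(p_i/p_j)` and `ln(p_j/p_i)` cancel. -/

namespace Graph

/-! ### Perron–Frobenius theory for symmetric nonnegative matrices -/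

section PerronFrobenius

variable {ι : Type*} [Fintype ι] [DecidableEq ι] {A : Matrix ι ι ℝ}

theorem exists_mulVec_eq_smul_of_mem_spectrum {μ : ℝ} (h : μ ∈ spectrum ℝ A) :
    ∃ v ≠ 0, A *ᵥ v = μ • v := by
  rw [spectrum.mem_iff, Matrix.isUnit_iff_isUnit_det, isUnit_iff_ne_zero, not_not,
    ← Matrix.exists_mulVec_eq_zero_iff] at h
  obtain ⟨v, hv, h⟩ := h
  refine ⟨v, hv, ?_⟩
  rw [Matrix.sub_mulVec, sub_eq_zero, Algebra.algebraMap_eq_smul_one, Matrix.smul_mulVec,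
    Matrix.one_mulVec] at h
  exact h.symm

theorem spectrum_real_nonempty [Nonempty ι] (hs : A.IsHermitian) : (spectrum ℝ A).Nonempty := by
  rw [hs.spectrum_real_eq_range_eigenvalues]
  exact Set.range_nonempty _

/-- The Perron root of a symmetric matrix is the greatest absolute value of an eigenvalue. -/
theorem exists_abs_eq_perronRoot [Nonempty ι] (hs : A.IsHermitian) :
    ∃ μ ∈ spectrum ℝ A, |μ| = perronRoot A ∧ ∀ ν ∈ spectrum ℝ A, |ν| ≤ perronRoot A := by
  obtain ⟨μ, hμ, hmax⟩ := Set.exists_max_image (spectrum ℝ A) (fun x => ‖x‖₊)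
    (Matrix.finite_spectrum A) (spectrum_real_nonempty hs)
  have h : spectralRadius ℝ A = ‖μ‖₊ :=
    le_antisymm (iSup₂_le fun ν hν => by exact_mod_cast hmax ν hν)
      (le_iSup₂ (f := fun (k : ℝ) (_ : k ∈ spectrum ℝ A) => (‖k‖₊ : ENNReal)) μ hμ)
  have h' : perronRoot A = |μ| := by simp [perronRoot, h]
  refine ⟨μ, hμ, h'.symm, fun ν hν => ?_⟩
  rw [h']
  exact_mod_cast hmax ν hν

theorem isHermitian_paraLaplacian (hs : A.IsHermitian) : (paraLaplacian A).IsHermitian := by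
  have : A.IsSymm := by simpa [Matrix.IsHermitian, Matrix.IsSymm] using hs
  simp [paraLaplacian, Matrix.IsHermitian, this.eq]

theorem posSemidef_paraLaplacian [Nonempty ι] (hs : A.IsHermitian) :
    (paraLaplacian A).PosSemidef := by
  rw [Matrix.posSemidef_iff_isHermitian_and_spectrum_nonneg]
  refine ⟨isHermitian_paraLaplacian hs, ?_⟩
  obtain ⟨μ, -, -, h⟩ := exists_abs_eq_perronRoot hs
  intro x hx
  rw [paraLaplacian, ← Algebra.algebraMap_eq_smul_one, ← spectrum.singleton_sub_eq] at hx
  obtain ⟨_, rfl, ν, hν, rfl⟩ := hx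
  have := (le_abs_self ν).trans (h ν hν)
  simpa using this

theorem paraLaplacian_mulVec (x : ι → ℝ) :
    paraLaplacian A *ᵥ x = perronRoot A • x - A *ᵥ x := by
  simp [paraLaplacian, Matrix.sub_mulVec, Matrix.smul_mulVec]

theorem pow_nonneg_entry (hn : ∀ i j, 0 ≤ A i j) (k : ℕ) (i j : ι) : 0 ≤ (A ^ k) i j := by
  induction k generalizing i j with
  | zero => rw [pow_zero, Matrix.one_apply]; split_ifs <;> simp
  | succ k ih =>
    rw [pow_succ, Matrix.mul_apply]
    exact Finset.sum_nonneg fun l _ => mul_nonneg (ih i l) (hn l j)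

theorem pow_mulVec_of_mulVec {ρ : ℝ} {x : ι → ℝ} (h : A *ᵥ x = ρ • x) (k : ℕ) :
    (A ^ k) *ᵥ x = ρ ^ k • x := by
  induction k with
  | zero => simp
  | succ k ih => rw [pow_succ, ← Matrix.mulVec_mulVec, h, Matrix.mulVec_smul, ih, smul_smul, pow_succ']

/-- A nonnegative eigenvector of an irreducible nonnegative matrix vanishes if one of its
entries does. -/
theorem eq_zero_of_mulVec_of_apply_eq_zero (hn : ∀ i j, 0 ≤ A i j)
    (hi : ∀ i j, ∃ k, 0 < (A ^ k) i j) {ρ : ℝ} {x : ι → ℝ} (h : A *ᵥ x = ρ • x)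
    (hx : ∀ i, 0 ≤ x i) {i : ι} (h0 : x i = 0) : x = 0 := by
  funext j
  obtain ⟨k, hk⟩ := hi i j
  have h1 := congrFun (pow_mulVec_of_mulVec h k) i
  rw [Pi.smul_apply, h0, smul_zero, Matrix.mulVec, dotProduct,
    Finset.sum_eq_zero_iff_of_nonneg fun l _ => mul_nonneg (pow_nonneg_entry hn k i l) (hx l)] at h1
  exact (mul_eq_zero.1 (h1 j (Finset.mem_univ j))).resolve_left hk.ne'

/-- If `v` belongs to an eigenvalue of greatest modulus, then `y = |v|` satisfies `ρ y ≤ A y`, so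
the quadratic form of `Λ` at `y` is nonpositive. As `Λ` is positive semidefinite, `Λ y = 0`. -/
theorem exists_isPerronVector [Nonempty ι] (hs : A.IsHermitian) (hn : ∀ i j, 0 ≤ A i j) :
    ∃ p, IsPerronVector A p := by
  obtain ⟨μ, hμ, hμρ, -⟩ := exists_abs_eq_perronRoot hs
  obtain ⟨v, hv, hAv⟩ := exists_mulVec_eq_smul_of_mem_spectrum hμ
  set y : ι → ℝ := fun i => |v i| with hy
  have hle : ∀ i, perronRoot A * y i ≤ (A *ᵥ y) i := fun i => by
    have h1 := congrFun hAv i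
    calc perronRoot A * y i = |(A *ᵥ v) i| := by rw [h1, ← hμρ]; simp [hy, abs_mul]
      _ ≤ ∑ j, |A i j * v j| := Finset.abs_sum_le_sum_abs _ _
      _ = (A *ᵥ y) i := by
        simp only [abs_mul, Matrix.mulVec, dotProduct, hy]
        exact Finset.sum_congr rfl fun j _ => by rw [abs_of_nonneg (hn i j)]
  have hps := posSemidef_paraLaplacian hs
  have hzero : paraLaplacian A *ᵥ y = 0 := by
    rw [← hps.dotProduct_mulVec_zero_iff]
    refine le_antisymm ?_ (hps.dotProduct_mulVec_nonneg y)
    refine Finset.sum_nonpos fun i _ => mul_nonpos_of_nonneg_of_nonpos (by simp [hy]) ?_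
    rw [paraLaplacian_mulVec]
    simpa using hle i
  have hsum : 0 < ∑ i, y i := by
    obtain ⟨i, hi⟩ := Function.ne_iff.1 hv
    exact Finset.sum_pos' (fun i _ => abs_nonneg _) ⟨i, Finset.mem_univ i, abs_pos.2 hi⟩
  refine ⟨(∑ i, y i)⁻¹ • y, ?_, fun i => ?_, ?_⟩
  · rw [paraLaplacian_mulVec, sub_eq_zero] at hzero
    rw [Matrix.mulVec_smul, ← hzero, smul_comm]
  · exact mul_nonneg (inv_nonneg.2 hsum.le) (abs_nonneg _)
  · simp only [Pi.smul_apply, smul_eq_mul, ← Finset.mul_sum]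
    exact inv_mul_cancel₀ hsum.ne'

theorem IsPerronVector.pos (hn : ∀ i j, 0 ≤ A i j) (hi : ∀ i j, ∃ k, 0 < (A ^ k) i j)
    {p : ι → ℝ} (hp : IsPerronVector A p) (i : ι) : 0 < p i := by
  refine lt_of_le_of_ne (hp.2.1 i) fun h => ?_
  have := eq_zero_of_mulVec_of_apply_eq_zero hn hi hp.1 hp.2.1 h.symm
  simpa [this] using hp.2.2

/-- The eigenspace of the Perron root is one-dimensional. -/
theorem IsPerronVector.exists_eq_smul (hn : ∀ i j, 0 ≤ A i j)
    (hi : ∀ i j, ∃ k, 0 < (A ^ k) i j) {p : ι → ℝ} (hp : IsPerronVector A p) {x : ι → ℝ}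
    (hx : A *ᵥ x = perronRoot A • x) : ∃ c : ℝ, x = c • p := by
  rcases isEmpty_or_nonempty ι with _ | _
  · exact ⟨0, Subsingleton.elim _ _⟩
  have hpos := hp.pos hn hi
  -- With `c` the least ratio `x i / p i`, the eigenvector `x - c p` is nonnegative and has a zero
  -- entry.
  obtain ⟨i, -, hmin⟩ := Finset.exists_min_image Finset.univ (fun i => x i / p i)
    Finset.univ_nonempty
  refine ⟨x i / p i, sub_eq_zero.1 (eq_zero_of_mulVec_of_apply_eq_zero hn hi (ρ := perronRoot A)
    (i := i) ?_ (fun j => ?_) ?_)⟩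
  · rw [Matrix.mulVec_sub, Matrix.mulVec_smul, hx, hp.1, smul_sub, smul_comm]
  · have := hmin j (Finset.mem_univ j)
    rw [le_div_iff₀ (hpos j)] at this
    simpa using this
  · simp [(hpos i).ne']

theorem existsUnique_isPerronVector [Nonempty ι] (hs : A.IsHermitian) (hn : ∀ i j, 0 ≤ A i j)
    (hi : ∀ i j, ∃ k, 0 < (A ^ k) i j) : ∃! p, IsPerronVector A p := by
  obtain ⟨p, hp⟩ := exists_isPerronVector hs hn
  refine ⟨p, hp, fun q hq => ?_⟩
  obtain ⟨c, rfl⟩ := hp.exists_eq_smul hn hi hq.1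
  have := hq.2.2
  simp only [Pi.smul_apply, smul_eq_mul, ← Finset.mul_sum, hp.2.2, mul_one] at this
  rw [this, one_smul]

/-- If `ρ = 0`, then `A ^ k` kills the positive vector `p` for every `k ≥ 1`. Two distinct indices
are needed so that irreducibility supplies a positive entry with `k ≠ 0`. -/
theorem perronRoot_pos [Nontrivial ι] (hs : A.IsHermitian) (hn : ∀ i j, 0 ≤ A i j)
    (hi : ∀ i j, ∃ k, 0 < (A ^ k) i j) : 0 < perronRoot A := by
  refine lt_of_le_of_ne ENNReal.toReal_nonneg fun h => ?_
  obtain ⟨p, hp⟩ := exists_isPerronVector hs hn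
  obtain ⟨i, j, hij⟩ := exists_pair_ne ι
  obtain ⟨k, hk⟩ := hi i j
  have hk0 : k ≠ 0 := by
    rintro rfl
    simp [hij] at hk
  have h1 := congrFun (pow_mulVec_of_mulVec hp.1 k) i
  rw [← h, zero_pow hk0, zero_smul, Pi.zero_apply, Matrix.mulVec, dotProduct,
    Finset.sum_eq_zero_iff_of_nonneg fun l _ =>
      mul_nonneg (pow_nonneg_entry hn k i l) (hp.2.1 l)] at h1
  exact (mul_pos hk (hp.pos hn hi j)).ne' (h1 j (Finset.mem_univ j))

theorem sum_eq_sum_ne (j : ι) {f : ι → ℝ} (hf : f j = 0) :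
    ∑ k, f k = ∑ k : {k // k ≠ j}, f k := by
  rw [← Fintype.sum_subtype_add_sum_subtype (fun k => k ≠ j) f, add_eq_left]
  exact Finset.sum_eq_zero fun k _ => by rw [not_not.1 k.2, hf]

/-- A kernel vector of `Λ_jj`, extended by `0` at `j`, makes the quadratic form of `Λ` vanish, so it
lies in the kernel of `Λ` and is a multiple of `p`. Its zero entry at `j` forces the multiple to be
`0`. -/
theorem isUnit_det_removeRowCol_paraLaplacian [Nonempty ι] (hs : A.IsHermitian)
    (hn : ∀ i j, 0 ≤ A i j) (hi : ∀ i j, ∃ k, 0 < (A ^ k) i j) (j : ι) :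
    IsUnit (removeRowCol (paraLaplacian A) j).det := by
  rw [isUnit_iff_ne_zero]
  intro h
  rw [← Matrix.exists_mulVec_eq_zero_iff] at h
  obtain ⟨v, hv, h⟩ := h
  apply hv
  set y : ι → ℝ := fun k => if hk : k = j then 0 else v ⟨k, hk⟩ with hy
  have hyj : y j = 0 := by simp [hy]
  have hyv : ∀ k : {k // k ≠ j}, y k = v k := fun k => by simp [hy, k.2]
  have hrow : ∀ k : {k // k ≠ j}, (paraLaplacian A *ᵥ y) k = 0 := fun k => by
    refine Eq.trans ?_ (congrFun h k)
    rw [Matrix.mulVec, dotProduct, sum_eq_sum_ne j (by simp [hyj])]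
    exact Finset.sum_congr rfl fun l _ => by rw [hyv]; rfl
  have hps := posSemidef_paraLaplacian hs
  have hzero : paraLaplacian A *ᵥ y = 0 := by
    rw [← hps.dotProduct_mulVec_zero_iff, star_trivial, dotProduct]
    refine Finset.sum_eq_zero fun k _ => ?_
    by_cases hk : k = j
    · rw [hk, hyj, zero_mul]
    · rw [hrow ⟨k, hk⟩, mul_zero]
  rw [paraLaplacian_mulVec, sub_eq_zero] at hzero
  obtain ⟨p, hp⟩ := exists_isPerronVector hs hn
  obtain ⟨c, hc⟩ := hp.exists_eq_smul hn hi hzero.symm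
  have hc0 : c = 0 := by
    have := congrFun hc j
    rw [hyj, Pi.smul_apply, smul_eq_mul, zero_eq_mul] at this
    exact this.resolve_right (hp.pos hn hi j).ne'
  funext k
  rw [← hyv, hc, hc0, zero_smul]
  rfl

end PerronFrobenius

/-! ### Neumann series of nonnegative matrices -/

section NeumannSeries

variable {ι : Type*} [Fintype ι] [DecidableEq ι] {A B : Matrix ι ι ℝ}

theorem pow_le_pow_entry (hB : ∀ i j, 0 ≤ B i j) (h : ∀ i j, B i j ≤ A i j) (k : ℕ) (i j : ι) :
    (B ^ k) i j ≤ (A ^ k) i j := by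
  induction k generalizing i j with
  | zero => simp
  | succ k ih =>
    rw [pow_succ, pow_succ, Matrix.mul_apply, Matrix.mul_apply]
    exact Finset.sum_le_sum fun l _ => mul_le_mul (ih i l) (h l j) (hB l j)
      ((pow_nonneg_entry hB k i l).trans (ih i l))

/-- The Neumann series of a nonnegative matrix converges if the matrix strictly contracts
a positive vector. -/
theorem summable_pow_of_mulVec_eq (hB : ∀ i j, 0 ≤ B i j) (h : ∀ i j, B i j ≤ A i j) {δ : ℝ}
    (h0 : 0 ≤ δ) (h1 : δ < 1) {p : ι → ℝ} (hp : ∀ i, 0 < p i) (hA : A *ᵥ p = δ • p) :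
    Summable fun k : ℕ => B ^ k := by
  refine Pi.summable.2 fun i => Pi.summable.2 fun j => ?_
  -- The bound is `(A ^ k) i j * p j ≤ (A ^ k *ᵥ p) i = δ ^ k * p i`.
  refine Summable.of_nonneg_of_le (fun k => pow_nonneg_entry hB k i j) (fun k => ?_)
    ((summable_geometric_of_lt_one h0 h1).mul_right (p i / p j))
  have h2 := congrFun (pow_mulVec_of_mulVec hA k) i
  have hA0 := fun i j => (hB i j).trans (h i j)
  refine (pow_le_pow_entry hB h k i j).trans ?_
  rw [← mul_div_assoc, le_div_iff₀ (hp j)]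
  rw [Pi.smul_apply, smul_eq_mul, Matrix.mulVec, dotProduct] at h2
  rw [← h2]
  exact Finset.single_le_sum (f := fun l => (A ^ k) i l * p l)
    (fun l _ => mul_nonneg (pow_nonneg_entry hA0 k i l) (hp l).le) (Finset.mem_univ j)

theorem tsum_pow_apply (hS : Summable fun k : ℕ => B ^ k) (i j : ι) :
    (∑' k : ℕ, B ^ k) i j = ∑' k : ℕ, (B ^ k) i j :=
  (Pi.hasSum.1 (Pi.hasSum.1 hS.hasSum i) j).tsum_eq.symm

theorem summable_pow_apply (hS : Summable fun k : ℕ => B ^ k) (i j : ι) :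
    Summable fun k : ℕ => (B ^ k) i j :=
  Pi.summable.1 (Pi.summable.1 hS i) j

theorem pow_apply_le_tsum_pow (hB : ∀ i j, 0 ≤ B i j) (hS : Summable fun k : ℕ => B ^ k) (k : ℕ)
    (i j : ι) : (B ^ k) i j ≤ (∑' k : ℕ, B ^ k) i j := by
  rw [tsum_pow_apply hS]
  exact (summable_pow_apply hS i j).le_tsum k fun l _ => pow_nonneg_entry hB l i j

theorem one_sub_mul_tsum_pow (hS : Summable fun k : ℕ => B ^ k) :
    (1 - B) * ∑' k : ℕ, B ^ k = 1 := by
  rw [sub_mul, one_mul, sub_eq_iff_eq_add, ← hS.tsum_mul_left,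
    hS.tsum_eq_zero_add, pow_zero]
  simp only [pow_succ']

theorem tsum_pow_symm (hs : B.IsSymm) (hS : Summable fun k : ℕ => B ^ k) (i j : ι) :
    (∑' k : ℕ, B ^ k) i j = (∑' k : ℕ, B ^ k) j i := by
  rw [tsum_pow_apply hS, tsum_pow_apply hS]
  refine tsum_congr fun k => ?_
  exact (hs.pow k).apply j i

end NeumannSeries

/-! ### Walks, simple paths and the shortest path distance -/

section Walks

variable {α β : Type*} {G : Graph α β} {w : β → ℝ}

theorem EdgeWalk.edges_mem {x y : α} (π : EdgeWalk G x y) : ∀ e ∈ π.edges, e ∈ E(G) := by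
  induction π with
  | nil x hx => simp [EdgeWalk.edges]
  | cons e h π ih =>
    intro f hf
    rcases List.mem_cons.1 hf with rfl | hf
    · exact h.edge_mem
    · exact ih f hf

theorem EdgeWalk.verts_mem {x y : α} (π : EdgeWalk G x y) : ∀ z ∈ π.verts, z ∈ V(G) := by
  induction π with
  | nil x hx => simp [EdgeWalk.verts, hx]
  | cons e h π ih =>
    intro f hf
    rcases List.mem_cons.1 hf with rfl | hf
    · exact h.left_mem
    · exact ih f hf

theorem EdgeWalk.length_verts {x y : α} (π : EdgeWalk G x y) :
    π.verts.length = π.edges.length + 1 := by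
  induction π with
  | nil x hx => rfl
  | cons e h π ih => simp [EdgeWalk.verts, EdgeWalk.edges, ih]

theorem EdgeWalk.weightedLength_cons {x y z : α} (e : β) (h : G.IsLink e x y)
    (π : EdgeWalk G y z) : (cons e h π).weightedLength w = 1 / w e + π.weightedLength w := by
  simp [EdgeWalk.weightedLength, EdgeWalk.edges]

theorem EdgeWalk.weightedLength_nonneg (hw : ∀ e ∈ E(G), 0 < w e) {x y : α}
    (π : EdgeWalk G x y) : 0 ≤ π.weightedLength w := by
  refine List.sum_nonneg fun l hl => ?_
  obtain ⟨e, he, rfl⟩ := List.mem_map.1 hl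
  exact (one_div_pos.2 (hw e (π.edges_mem e he))).le

/-- The part of `π` from `x` onwards works: the edges cut off have positive length. -/
theorem EdgeWalk.exists_isSimplePath_of_mem_verts (hw : ∀ e ∈ E(G), 0 < w e) {x y z : α}
    (π : EdgeWalk G y z) (hπ : π.IsSimplePath) (hx : x ∈ π.verts) :
    ∃ π' : EdgeWalk G x z, π'.IsSimplePath ∧ π'.weightedLength w ≤ π.weightedLength w := by
  induction π with
  | nil y hy =>
    obtain rfl : x = y := by simpa [EdgeWalk.verts] using hx
    exact ⟨nil x hy, hπ, le_rfl⟩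
  | @cons y u z e h π ih =>
    by_cases hxy : x = y
    · subst hxy
      exact ⟨cons e h π, hπ, le_rfl⟩
    · obtain ⟨π', h1, h2⟩ := ih (List.nodup_cons.1 hπ).2 ((List.mem_cons.1 hx).resolve_left hxy)
      refine ⟨π', h1, h2.trans ?_⟩
      rw [weightedLength_cons]
      linarith [one_div_pos.2 (hw e h.edge_mem)]

/-- Every walk contains a simple path with the same ends. -/
theorem EdgeWalk.exists_isSimplePath (hw : ∀ e ∈ E(G), 0 < w e) {x y : α}
    (π : EdgeWalk G x y) :
    ∃ π' : EdgeWalk G x y, π'.IsSimplePath ∧ π'.weightedLength w ≤ π.weightedLength w := by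
  induction π with
  | nil x hx => exact ⟨nil x hx, by simp [IsSimplePath, verts], le_rfl⟩
  | @cons x u y e h π ih =>
    obtain ⟨π', h1, h2⟩ := ih
    have he := one_div_pos.2 (hw e h.edge_mem)
    by_cases hx : x ∈ π'.verts
    · obtain ⟨π'', h3, h4⟩ := π'.exists_isSimplePath_of_mem_verts hw h1 hx
      refine ⟨π'', h3, ?_⟩
      rw [weightedLength_cons]
      linarith
    · refine ⟨cons e h π', List.nodup_cons.2 ⟨hx, h1⟩, ?_⟩
      rw [weightedLength_cons, weightedLength_cons]
      linarith

/-- A simple path has fewer edges than `G` has vertices, and edge lists of bounded length are finite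
in number. -/
theorem finite_pathLengths [Fintype V(G)] [Fintype E(G)] (i j : V(G)) :
    (G.pathLengths w i j).Finite := by
  refine ((List.finite_length_le E(G) (Fintype.card V(G))).image
    fun l => ((l.map Subtype.val).map fun e => 1 / w e).sum).subset ?_
  rintro _ ⟨π, hπ, rfl⟩
  refine ⟨π.edges.attachWith (· ∈ E(G)) π.edges_mem, ?_, ?_⟩
  · have h1 : (π.verts.attachWith (· ∈ V(G)) π.verts_mem).Nodup := by
      apply List.Nodup.of_map Subtype.val
      rw [List.attachWith_map_subtype_val]
      exact hπ
    have h2 : (π.verts.attachWith (· ∈ V(G)) π.verts_mem).length ≤ Fintype.card V(G) :=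
      h1.length_le_card
    rw [List.length_attachWith, π.length_verts] at h2
    rw [Set.mem_ofPred_eq, List.length_attachWith]
    omega
  · simp only [EdgeWalk.weightedLength, List.attachWith_map_subtype_val]

theorem isLeast_weightedShortestPathDist [Fintype V(G)] [Fintype E(G)] (hG : G.WalkConnected)
    (hw : ∀ e ∈ E(G), 0 < w e) (i j : V(G)) :
    IsLeast (G.pathLengths w i j) (G.weightedShortestPathDist w i j) := by
  have hne : (G.pathLengths w i j).Nonempty := by
    obtain ⟨π⟩ := hG i j
    obtain ⟨π', h, -⟩ := π.exists_isSimplePath hw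
    exact ⟨_, π', h, rfl⟩
  have hfin := finite_pathLengths (w := w) i j
  exact ⟨hne.csInf_mem hfin, fun x hx => csInf_le hfin.bddBelow hx⟩

theorem weightedShortestPathDist_le [Fintype V(G)] [Fintype E(G)] (hG : G.WalkConnected)
    (hw : ∀ e ∈ E(G), 0 < w e) {i j : V(G)} (π : EdgeWalk G (i : α) (j : α)) :
    G.weightedShortestPathDist w i j ≤ π.weightedLength w := by
  obtain ⟨π', h, hle⟩ := π.exists_isSimplePath hw
  exact ((isLeast_weightedShortestPathDist hG hw i j).2 ⟨π', h, rfl⟩).trans hle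

theorem weightedShortestPathDist_self [Fintype V(G)] [Fintype E(G)] (hG : G.WalkConnected)
    (hw : ∀ e ∈ E(G), 0 < w e) (i : V(G)) : G.weightedShortestPathDist w i i = 0 := by
  refine le_antisymm (weightedShortestPathDist_le hG hw (EdgeWalk.nil (i : α) i.2)) ?_
  obtain ⟨π, -, h⟩ := (isLeast_weightedShortestPathDist hG hw i i).1
  exact h ▸ π.weightedLength_nonneg hw

theorem weightedShortestPathDist_le_add [Fintype V(G)] [Fintype E(G)] (hG : G.WalkConnected)
    (hw : ∀ e ∈ E(G), 0 < w e) {e : β} {i l : V(G)} (h : G.IsLink e i l) (j : V(G)) :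
    G.weightedShortestPathDist w i j ≤ 1 / w e + G.weightedShortestPathDist w l j := by
  obtain ⟨π, -, hπ⟩ := (isLeast_weightedShortestPathDist hG hw l j).1
  rw [← hπ, ← EdgeWalk.weightedLength_cons e h π]
  exact weightedShortestPathDist_le hG hw _

end Walks

/-! ### Walk weights and powers of the adjacency matrix -/

section WeightedAdj

variable {α β : Type*} {G : Graph α β} {v u : β → ℝ}

theorem prod_edges_pos (hv : ∀ e ∈ E(G), 0 < v e) {x y : α} (π : EdgeWalk G x y) :
    0 < (π.edges.map v).prod := by
  refine List.prod_pos fun l hl => ?_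
  obtain ⟨f, hf, rfl⟩ := List.mem_map.1 hl
  exact hv f (π.edges_mem f hf)

variable [Fintype E(G)]

theorem weightedAdj_nonneg (hv : ∀ e ∈ E(G), 0 ≤ v e) (i j : V(G)) :
    0 ≤ G.weightedAdj v i j := by
  classical
  exact Finset.sum_nonneg fun e _ => by split_ifs; exacts [hv e e.2, le_rfl]

theorem weightedAdj_isSymm (v : β → ℝ) : (G.weightedAdj v).IsSymm := by
  ext i j
  classical
  exact Finset.sum_congr rfl fun e _ => if_congr isLink_comm rfl rfl

theorem weightedAdj_isHermitian (v : β → ℝ) : (G.weightedAdj v).IsHermitian := by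
  simpa [Matrix.IsHermitian] using (weightedAdj_isSymm v).eq

theorem le_weightedAdj (hv : ∀ e ∈ E(G), 0 ≤ v e) {e : β} {i j : V(G)} (h : G.IsLink e i j) :
    v e ≤ G.weightedAdj v i j := by
  classical
  have := Finset.single_le_sum (f := fun e : E(G) => if G.IsLink (e : β) (i : α) (j : α)
    then v e else 0) (fun e _ => by split_ifs; exacts [hv e e.2, le_rfl])
    (Finset.mem_univ ⟨e, h.edge_mem⟩)
  simpa [weightedAdj, h] using this

theorem NoParallelEdges.multiplicityMatrix_eq (hN : G.NoParallelEdges)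
    (hv : ∀ e ∈ E(G), 0 < v e) :
    G.multiplicityMatrix = supportMatrix (G.weightedAdj v) := by
  classical
  ext i j
  simp only [multiplicityMatrix, supportMatrix, Matrix.of_apply]
  by_cases h : ∃ e, G.IsLink e i j
  · obtain ⟨e, he⟩ := h
    have h1 : (Finset.univ.filter fun f : E(G) => G.IsLink (f : β) (i : α) (j : α)) =
        {⟨e, he.edge_mem⟩} := by
      ext f
      simp only [Finset.mem_filter, Finset.mem_univ, true_and, Finset.mem_singleton]
      exact ⟨fun hf => Subtype.ext (hN _ _ _ _ hf he), fun hf => hf ▸ he⟩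
    have h2 := (hv e he.edge_mem).trans_le (le_weightedAdj (fun e he => (hv e he).le) he)
    rw [h1, Finset.card_singleton, if_neg h2.ne', Nat.cast_one]
  · push Not at h
    have h1 : G.weightedAdj v i j = 0 :=
      Finset.sum_eq_zero fun e _ => if_neg (h e)
    simp [h1, h]

variable [DecidableEq α] [Fintype V(G)]

/-- The weight of a single walk is one of the nonnegative terms in the expansion of the matrix
power. -/
theorem prod_le_weightedAdj_pow (hv : ∀ e ∈ E(G), 0 ≤ v e) {x y : α} (π : EdgeWalk G x y)
    (hx : x ∈ V(G)) (hy : y ∈ V(G)) :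
    (π.edges.map v).prod ≤ (G.weightedAdj v ^ π.edges.length) ⟨x, hx⟩ ⟨y, hy⟩ := by
  have hn := weightedAdj_nonneg hv
  induction π with
  | nil x _ => simp [EdgeWalk.edges]
  | @cons x z y e h π ih =>
    have hz := h.right_mem
    simp only [EdgeWalk.edges, List.map_cons, List.prod_cons, List.length_cons, pow_succ',
      Matrix.mul_apply]
    refine (mul_le_mul (le_weightedAdj hv (i := ⟨x, hx⟩) (j := ⟨z, hz⟩) h) (ih hz hy)
      (List.prod_nonneg fun l hl => ?_) (hn _ _)).trans ?_
    · obtain ⟨f, hf, rfl⟩ := List.mem_map.1 hl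
      exact hv f (π.edges_mem f hf)
    · exact Finset.single_le_sum (f := fun l => G.weightedAdj v ⟨x, hx⟩ l *
        (G.weightedAdj v ^ π.edges.length) l ⟨y, hy⟩)
        (fun l _ => mul_nonneg (hn _ _) (pow_nonneg_entry hn _ _ _)) (Finset.mem_univ _)

theorem exists_weightedAdj_pow_pos (hG : G.WalkConnected) (hv : ∀ e ∈ E(G), 0 < v e)
    (i j : V(G)) : ∃ k, 0 < (G.weightedAdj v ^ k) i j := by
  obtain ⟨π⟩ := hG i j
  exact ⟨_, (prod_edges_pos hv π).trans_le
    (prod_le_weightedAdj_pow (fun e he => (hv e he).le) π i.2 j.2)⟩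

/-- If the edge weights decay exponentially in the edge lengths, the walk weights decay
exponentially in the distance. -/
theorem weightedAdj_pow_le_mul_exp (hv : ∀ e ∈ E(G), 0 ≤ v e) (hu : ∀ e ∈ E(G), 0 ≤ u e)
    {t : ℝ} (ht : 0 ≤ t) {ℓ : β → ℝ} (hvu : ∀ e ∈ E(G), v e ≤ u e * Real.exp (-(t * ℓ e)))
    {D : V(G) → V(G) → ℝ} (hD0 : ∀ i, D i i = 0)
    (hD : ∀ (e : β) (i l : V(G)), G.IsLink e i l → ∀ j, D i j ≤ ℓ e + D l j) (k : ℕ)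
    (i j : V(G)) :
    (G.weightedAdj v ^ k) i j ≤ (G.weightedAdj u ^ k) i j * Real.exp (-(t * D i j)) := by
  classical
  induction k generalizing i with
  | zero =>
    by_cases h : i = j
    · simp [h, hD0]
    · simp [h]
  | succ k ih =>
    rw [pow_succ', pow_succ', Matrix.mul_apply, Matrix.mul_apply, Finset.sum_mul]
    refine Finset.sum_le_sum fun l _ => ?_
    have hnu := pow_nonneg_entry (weightedAdj_nonneg hu) k l j
    refine (mul_le_mul_of_nonneg_left (ih l) (weightedAdj_nonneg hv i l)).trans ?_
    -- Once the common factor is pulled out, the inequality can be checked edge by edge.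
    rw [mul_left_comm, mul_assoc, mul_left_comm (G.weightedAdj u i l)]
    refine mul_le_mul_of_nonneg_left ?_ hnu
    simp only [weightedAdj, Matrix.of_apply, Finset.sum_mul]
    refine Finset.sum_le_sum fun e _ => ?_
    split_ifs with he
    · calc v e * Real.exp (-(t * D l j))
          ≤ u e * Real.exp (-(t * ℓ e)) * Real.exp (-(t * D l j)) :=
            mul_le_mul_of_nonneg_right (hvu e e.2) (Real.exp_pos _).le
        _ = u e * Real.exp (-(t * (ℓ e + D l j))) := by
            rw [mul_assoc, ← Real.exp_add]; ring_nf
        _ ≤ u e * Real.exp (-(t * D i j)) := by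
            refine mul_le_mul_of_nonneg_left (Real.exp_le_exp.2 (neg_le_neg ?_)) (hu e e.2)
            exact mul_le_mul_of_nonneg_left (hD e i l he j) ht
    · simp

end WeightedAdj

/-! ### Convergence, positivity and the limit at zero -/

section EWalk

variable {α β : Type*} [DecidableEq α] {G : Graph α β} [Fintype V(G)] [Fintype E(G)]
  {w : β → ℝ}

theorem perronRoot_weightedAdj_pos (hV : 1 < Fintype.card V(G)) (hG : G.WalkConnected)
    (hw : ∀ e ∈ E(G), 0 < w e) : 0 < perronRoot (G.weightedAdj w) := by
  have := Fintype.one_lt_card_iff_nontrivial.1 hV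
  exact perronRoot_pos (weightedAdj_isHermitian w) (weightedAdj_nonneg fun e he => (hw e he).le)
    (exists_weightedAdj_pow_pos hG hw)

theorem eWeight_pos (hV : 1 < Fintype.card V(G)) (hG : G.WalkConnected)
    (hw : ∀ e ∈ E(G), 0 < w e) (a : ℝ) : ∀ e ∈ E(G), 0 < G.eWeight w a e := fun e he =>
  mul_pos (div_pos (hw e he) (perronRoot_weightedAdj_pos hV hG hw)) (Real.exp_pos _)

/-- The transformation of the edge weights strictly contracts the scaled adjacency matrix. -/
theorem exists_eAdj_le (hV : 1 < Fintype.card V(G)) (hG : G.WalkConnected)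
    (hw : ∀ e ∈ E(G), 0 < w e) {a : ℝ} (ha : 0 < a) :
    ∃ δ, 0 ≤ δ ∧ δ < 1 ∧
      ∀ i j, G.eAdj w a i j ≤ (δ / perronRoot (G.weightedAdj w)) * G.weightedAdj w i j := by
  classical
  have hρ := perronRoot_weightedAdj_pos hV hG hw
  obtain ⟨δ, h0, h1, hδ⟩ : ∃ δ, 0 ≤ δ ∧ δ < 1 ∧
      ∀ e : E(G), Real.exp (-(1 / (a * w e))) ≤ δ := by
    rcases isEmpty_or_nonempty E(G) with _ | _
    · exact ⟨0, le_rfl, one_pos, fun e => isEmptyElim e⟩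
    · obtain ⟨e, -, he⟩ := Finset.exists_max_image Finset.univ
        (fun e : E(G) => Real.exp (-(1 / (a * w e)))) Finset.univ_nonempty
      refine ⟨_, (Real.exp_pos _).le, ?_, fun f => he f (Finset.mem_univ f)⟩
      rw [Real.exp_lt_one_iff]
      exact neg_neg_of_pos (one_div_pos.2 (mul_pos ha (hw e e.2)))
  refine ⟨δ, h0, h1, fun i j => ?_⟩
  simp only [eAdj, weightedAdj, Matrix.of_apply, Finset.mul_sum]
  refine Finset.sum_le_sum fun e _ => ?_
  split_ifs
  · have h2 := mul_le_mul_of_nonneg_left (hδ e) (div_pos (hw e e.2) hρ).le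
    calc _ ≤ _ := h2
      _ = _ := by simp only [weightedAdj]; ring
  · simp

theorem eAdj_nonneg (hV : 1 < Fintype.card V(G)) (hG : G.WalkConnected)
    (hw : ∀ e ∈ E(G), 0 < w e) (a : ℝ) (i j : V(G)) : 0 ≤ G.eAdj w a i j :=
  weightedAdj_nonneg (fun e he => (eWeight_pos hV hG hw a e he).le) i j

theorem summable_eAdj_pow (hV : 1 < Fintype.card V(G)) (hG : G.WalkConnected)
    (hw : ∀ e ∈ E(G), 0 < w e) {a : ℝ} (ha : 0 < a) : Summable fun k : ℕ => G.eAdj w a ^ k := by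
  have := Fintype.one_lt_card_iff_nontrivial.1 hV
  obtain ⟨δ, h0, h1, h⟩ := exists_eAdj_le hV hG hw ha
  have hn := weightedAdj_nonneg (G := G) fun e he => (hw e he).le
  obtain ⟨p, hp⟩ := exists_isPerronVector (weightedAdj_isHermitian (G := G) w) hn
  -- The dominating matrix `(δ / ρ) A` has eigenvector `p` with eigenvalue `δ < 1`.
  refine summable_pow_of_mulVec_eq
    (A := (δ / perronRoot (G.weightedAdj w)) • G.weightedAdj w) (eAdj_nonneg hV hG hw a)
    (fun i j => h i j) h0 h1 (hp.pos hn (exists_weightedAdj_pow_pos hG hw)) ?_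
  rw [Matrix.smul_mulVec, hp.1, smul_smul,
    div_mul_cancel₀ _ (perronRoot_weightedAdj_pos hV hG hw).ne']

theorem eWalkWeights_pos (hV : 1 < Fintype.card V(G)) (hG : G.WalkConnected)
    (hw : ∀ e ∈ E(G), 0 < w e) {a : ℝ} (ha : 0 < a) (i j : V(G)) :
    0 < G.eWalkWeights w a i j := by
  obtain ⟨k, hk⟩ := exists_weightedAdj_pow_pos hG (eWeight_pos hV hG hw a) i j
  exact hk.trans_le
    (pow_apply_le_tsum_pow (eAdj_nonneg hV hG hw a) (summable_eAdj_pow hV hG hw ha) k i j)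

theorem eWalkWeights_symm (hV : 1 < Fintype.card V(G)) (hG : G.WalkConnected)
    (hw : ∀ e ∈ E(G), 0 < w e) {a : ℝ} (ha : 0 < a) (i j : V(G)) :
    G.eWalkWeights w a i j = G.eWalkWeights w a j i :=
  tsum_pow_symm (weightedAdj_isSymm _) (summable_eAdj_pow hV hG hw ha) i j

/-- Passing from parameter `1` to `a` multiplies the weight of an edge by `exp(-(1/a - 1)/w)`, so a
walk loses at least the exponential of its distance. The prefactor does not depend on how many walks
there are at `a`. -/
theorem eWalkWeights_le (hV : 1 < Fintype.card V(G)) (hG : G.WalkConnected)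
    (hw : ∀ e ∈ E(G), 0 < w e) {a : ℝ} (ha : 0 < a) (ha1 : a ≤ 1) (i j : V(G)) :
    G.eWalkWeights w a i j ≤ G.eWalkWeights w 1 i j *
      Real.exp (-((1 / a - 1) * G.weightedShortestPathDist w i j)) := by
  have hS := summable_pow_apply (summable_eAdj_pow hV hG hw ha) i j
  have hS1 := summable_pow_apply (summable_eAdj_pow hV hG hw one_pos) i j
  rw [eWalkWeights, eWalkWeights, tsum_pow_apply (summable_eAdj_pow hV hG hw ha),
    tsum_pow_apply (summable_eAdj_pow hV hG hw one_pos), ← tsum_mul_right]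
  refine hS.tsum_le_tsum (fun k => ?_) (hS1.mul_right _)
  refine weightedAdj_pow_le_mul_exp (fun e he => (eWeight_pos hV hG hw a e he).le)
    (fun e he => (eWeight_pos hV hG hw 1 e he).le) (ℓ := fun e => 1 / w e)
    (sub_nonneg.2 (one_le_one_div ha ha1)) (fun e he => le_of_eq ?_)
    (weightedShortestPathDist_self hG hw)
    (fun e i l h j => weightedShortestPathDist_le_add hG hw h j) k i j
  have := (hw e he).ne'
  rw [eWeight, eWeight, mul_assoc, ← Real.exp_add]
  congr 2
  field_simp
  ring

theorem prod_map_mul_exp (c : β → ℝ) {a : ℝ} (ha : 0 < a) (l : List β) :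
    (l.map fun e => c e * Real.exp (-(1 / (a * w e)))).prod =
      (l.map c).prod * Real.exp (-((l.map fun e => 1 / w e).sum / a)) := by
  induction l with
  | nil => simp
  | cons e l ih =>
    simp only [List.map_cons, List.prod_cons, List.sum_cons, ih]
    rw [mul_mul_mul_comm, ← Real.exp_add]
    congr 2
    field_simp
    ring

/-- One shortest path suffices, with `C` the product of `w / ρ` along it, which does not depend on
`a`. -/
theorem exists_le_eWalkWeights (hV : 1 < Fintype.card V(G)) (hG : G.WalkConnected)
    (hw : ∀ e ∈ E(G), 0 < w e) (i j : V(G)) :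
    ∃ C, 0 < C ∧ ∀ a, 0 < a →
      C * Real.exp (-(G.weightedShortestPathDist w i j / a)) ≤ G.eWalkWeights w a i j := by
  obtain ⟨π, -, hπ⟩ := (isLeast_weightedShortestPathDist hG hw i j).1
  refine ⟨(π.edges.map fun e => w e / perronRoot (G.weightedAdj w)).prod,
    prod_edges_pos (fun e he => div_pos (hw e he) (perronRoot_weightedAdj_pos hV hG hw)) π,
    fun a ha => ?_⟩
  rw [← hπ, EdgeWalk.weightedLength, ← prod_map_mul_exp _ ha]
  exact (prod_le_weightedAdj_pow (v := G.eWeight w a)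
    (fun e he => (eWeight_pos hV hG hw a e he).le) π i.2 j.2).trans
    (pow_apply_le_tsum_pow (eAdj_nonneg hV hG hw a) (summable_eAdj_pow hV hG hw ha) _ i j)

/-- After taking logarithms, the constant prefactors of both bounds are multiplied by `a` and vanish
in the limit. -/
theorem tendsto_mul_log_eWalkWeights (hV : 1 < Fintype.card V(G)) (hG : G.WalkConnected)
    (hw : ∀ e ∈ E(G), 0 < w e) (i j : V(G)) :
    Tendsto (fun a => a * Real.log (G.eWalkWeights w a i j)) (𝓝[>] 0)
      (𝓝 (-G.weightedShortestPathDist w i j)) := by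
  set d := G.weightedShortestPathDist w i j
  obtain ⟨C, hC, hle⟩ := exists_le_eWalkWeights hV hG hw i j
  have hlow : Tendsto (fun a : ℝ => a * Real.log C - d) (𝓝[>] 0) (𝓝 (-d)) := by
    have : Continuous fun a : ℝ => a * Real.log C - d := by fun_prop
    exact (this.tendsto' 0 (-d) (by simp)).mono_left nhdsWithin_le_nhds
  have hup : Tendsto (fun a : ℝ => a * Real.log (G.eWalkWeights w 1 i j) - (1 - a) * d)
      (𝓝[>] 0) (𝓝 (-d)) := by
    have : Continuous fun a : ℝ => a * Real.log (G.eWalkWeights w 1 i j) - (1 - a) * d := by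
      fun_prop
    exact (this.tendsto' 0 (-d) (by simp)).mono_left nhdsWithin_le_nhds
  refine tendsto_of_tendsto_of_tendsto_of_le_of_le' hlow hup ?_ ?_
  · filter_upwards [self_mem_nhdsWithin] with a (ha : 0 < a)
    have h := Real.log_le_log (mul_pos hC (Real.exp_pos _)) (hle a ha)
    rw [Real.log_mul hC.ne' (Real.exp_pos _).ne', Real.log_exp] at h
    have h2 := mul_le_mul_of_nonneg_left h ha.le
    refine le_trans (le_of_eq ?_) h2
    field_simp
    rfl
  · filter_upwards [self_mem_nhdsWithin, nhdsWithin_le_nhds (Iic_mem_nhds one_pos)]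
      with a (ha : 0 < a) ha1
    have h := Real.log_le_log (eWalkWeights_pos hV hG hw ha i j)
      (eWalkWeights_le hV hG hw ha ha1 i j)
    rw [Real.log_mul (eWalkWeights_pos hV hG hw one_pos i j).ne' (Real.exp_pos _).ne',
      Real.log_exp] at h
    have h2 := mul_le_mul_of_nonneg_left h ha.le
    refine h2.trans (le_of_eq ?_)
    field_simp
    ring

theorem eWalkDist_eq (θ : ℝ → ℝ) (a : ℝ) (i j : V(G)) :
    G.eWalkDist w θ a i j = θ a * (1 / 2 * (a * Real.log (G.eWalkWeights w a i i) +
      a * Real.log (G.eWalkWeights w a j j)) - a * Real.log (G.eWalkWeights w a i j)) := by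
  simp only [eWalkDist, eLogWeights, Matrix.of_apply]
  ring

theorem tendsto_eWalkDist_nhdsGT_zero (hV : 1 < Fintype.card V(G)) (hG : G.WalkConnected)
    (hw : ∀ e ∈ E(G), 0 < w e) {θ : ℝ → ℝ} (hθ : Tendsto θ (𝓝[>] 0) (𝓝 1)) (i j : V(G)) :
    Tendsto (fun a : ℝ => G.eWalkDist w θ a i j) (𝓝[>] 0)
      (𝓝 (G.weightedShortestPathDist w i j)) := by
  have h := tendsto_mul_log_eWalkWeights hV hG hw
  have h2 := hθ.mul ((((h i i).add (h j j)).const_mul (1 / 2)).sub (h i j))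
  simpa [eWalkDist_eq, weightedShortestPathDist_self hG hw] using h2

end EWalk

/-! ### First-order asymptotics of column ratios -/

section RatioAsymptotics

theorem tendsto_of_tendsto_mul_sub {x : ℝ → ℝ} {q c : ℝ}
    (h : Tendsto (fun a => a * (x a - q)) atTop (𝓝 c)) : Tendsto x atTop (𝓝 q) := by
  have h1 := (tendsto_inv_atTop_zero.mul h).add_const q
  rw [zero_mul, zero_add] at h1
  refine h1.congr' ?_
  filter_upwards [eventually_ne_atTop 0] with a ha
  rw [inv_mul_cancel_left₀ ha, sub_add_cancel]

/-- The chain rule for first order asymptotics at infinity. -/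
theorem tendsto_mul_sub_comp {f x : ℝ → ℝ} {q c f' : ℝ} (hf : HasDerivAt f f' q)
    (h : Tendsto (fun a => a * (x a - q)) atTop (𝓝 c)) :
    Tendsto (fun a => a * (f (x a) - f q)) atTop (𝓝 (c * f')) := by
  -- `dslope` avoids dividing by `x a - q`, which may be zero.
  have h1 := (continuousAt_dslope_same.2 hf.differentiableAt).tendsto.comp
    (tendsto_of_tendsto_mul_sub h)
  rw [dslope_same, hf.deriv] at h1
  refine (h.mul h1).congr fun a => ?_
  rw [Function.comp_apply, ← sub_smul_dslope f q (x a), smul_eq_mul, mul_assoc]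

variable {ι : Type*} [Fintype ι] [DecidableEq ι]

theorem removeRowCol_mulVec {M : Matrix ι ι ℝ} {j : ι} {z : ι → ℝ} (hz : z j = 0)
    (k : {k // k ≠ j}) : (removeRowCol M j *ᵥ fun l => z l) k = (M *ᵥ z) k := by
  rw [Matrix.mulVec, Matrix.mulVec, dotProduct, dotProduct, sum_eq_sum_ne j (by simp [hz])]
  rfl

/-- The first order asymptotics of the ratios of the entries in a column of `(1 - B a)⁻¹` as `B a`
tends to a matrix with the fixed vector `q`. -/
theorem tendsto_mul_div_sub {B R : ℝ → Matrix ι ι ℝ} {A D : Matrix ι ι ℝ} {q : ι → ℝ} {j : ι}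
    (hR : ∀ᶠ a in atTop, (1 - B a) * R a = 1) (hR0 : ∀ᶠ a in atTop, R a j j ≠ 0)
    (hD : Tendsto (fun a => a • (B a - A)) atTop (𝓝 D)) (hq : A *ᵥ q = q) (hqj : q j = 1)
    (hu : IsUnit (removeRowCol (1 - A) j).det) (k : {k // k ≠ j}) :
    Tendsto (fun a => a * (R a k j / R a j j - q k)) atTop
      (𝓝 ((((removeRowCol (1 - A) j)⁻¹ * removeRow D j) *ᵥ q) k)) := by
  have hB : Tendsto B atTop (𝓝 A) := by
    have h1 := (tendsto_inv_atTop_zero.smul hD).add_const A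
    rw [zero_smul, zero_add] at h1
    refine h1.congr' ?_
    filter_upwards [eventually_ne_atTop 0] with a ha
    rw [inv_smul_smul₀ ha, sub_add_cancel]
  have hM : Tendsto (fun a => removeRowCol (1 - B a) j) atTop (𝓝 (removeRowCol (1 - A) j)) := by
    have : Continuous fun M : Matrix ι ι ℝ => removeRowCol (1 - M) j :=
      (continuous_const.sub continuous_id).matrix_submatrix _ _
    exact (this.tendsto A).comp hB
  have hdet : ∀ᶠ a in atTop, (removeRowCol (1 - B a) j).det ≠ 0 :=
    (((Continuous.matrix_det continuous_id).tendsto _).comp hM).eventually_ne hu.ne_zero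
  have hinv : Tendsto (fun a => (removeRowCol (1 - B a) j)⁻¹) atTop
      (𝓝 (removeRowCol (1 - A) j)⁻¹) := by
    refine Tendsto.comp (continuousAt_matrix_inv _ ?_) hM
    rw [Ring.inverse_eq_inv']
    exact continuousAt_inv₀ hu.ne_zero
  have hlim : Tendsto (fun a => (((removeRowCol (1 - B a) j)⁻¹ *
      removeRow (a • (B a - A)) j) *ᵥ q) k) atTop
      (𝓝 ((((removeRowCol (1 - A) j)⁻¹ * removeRow D j) *ᵥ q) k)) := by
    simp only [← Matrix.mulVec_mulVec]
    refine tendsto_finsetSum _ fun l _ => Tendsto.mul ?_ (tendsto_finsetSum _ fun m _ => ?_)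
    · exact tendsto_pi_nhds.1 (tendsto_pi_nhds.1 hinv k) l
    · exact (tendsto_pi_nhds.1 (tendsto_pi_nhds.1 hD l) m).mul_const (q m)
  refine hlim.congr' ?_
  filter_upwards [hR, hR0, hdet] with a h1 h2 h3
  -- The rescaled error vanishes at `j`, so deleting column `j` loses nothing.
  set z : ι → ℝ := fun l => a * (R a l j / R a j j - q l) with hz
  have hzj : z j = 0 := by simp [hz, h2, hqj]
  have hz' : z = a • ((R a j j)⁻¹ • (R a).col j - q) := by
    funext l
    simp [hz, div_eq_inv_mul]
  -- Off row `j`, `1 - B a` annihilates column `j` of `R a`, while `(1 - B a) q = -(B a - A) q`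
  -- because `A` fixes `q`.
  have key : (removeRowCol (1 - B a) j) *ᵥ (fun l => z l) =
      removeRow (a • (B a - A)) j *ᵥ q := by
    funext l
    have hcol : ((1 - B a) *ᵥ (R a).col j) (l : ι) = 0 := by
      have := congrFun (congrFun h1 (l : ι)) j
      rw [Matrix.one_apply_ne l.2] at this
      exact this
    have hfix : ((1 - B a) *ᵥ q) (l : ι) = -((B a - A) *ᵥ q) (l : ι) := by
      simp [Matrix.sub_mulVec, hq]
    have hrhs : (removeRow (a • (B a - A)) j *ᵥ q) l = a * ((B a - A) *ᵥ q) (l : ι) := by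
      rw [← smul_eq_mul a (_ : ℝ), ← Pi.smul_apply a ((B a - A) *ᵥ q), ← Matrix.smul_mulVec]
      rfl
    rw [removeRowCol_mulVec hzj, hrhs, hz', Matrix.mulVec_smul, Matrix.mulVec_sub,
      Matrix.mulVec_smul, Pi.smul_apply, Pi.sub_apply, Pi.smul_apply, hcol, hfix]
    simp
  rw [← Matrix.mulVec_mulVec, ← key, Matrix.mulVec_mulVec,
    Matrix.nonsing_inv_mul _ (isUnit_iff_ne_zero.2 h3), Matrix.one_mulVec]

end RatioAsymptotics

/-! ### The limit at infinity -/

section LongWalks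

variable {α β : Type*} [DecidableEq α] {G : Graph α β} [Fintype V(G)] [Fintype E(G)]
  {w : β → ℝ}

theorem tendsto_mul_exp_sub_one {x : ℝ} :
    Tendsto (fun a : ℝ => a * (Real.exp (-(1 / (a * x))) - 1)) atTop (𝓝 (-(1 / x))) := by
  have h : Tendsto (fun a : ℝ => a * (-(1 / (a * x)) - 0)) atTop (𝓝 (-(1 / x))) := by
    refine tendsto_const_nhds.congr' ?_
    filter_upwards [eventually_ne_atTop 0] with a ha
    rw [sub_zero, mul_neg, one_div, one_div, mul_inv, mul_inv_cancel_left₀ ha]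
  simpa using tendsto_mul_sub_comp (Real.hasDerivAt_exp 0) h

/-- Each edge contributes `(w/ρ)(-1/w) = -1/ρ`, independent of its weight, so only the number of
edges survives. -/
theorem tendsto_smul_eAdj_sub (hw : ∀ e ∈ E(G), 0 < w e) :
    Tendsto (fun a : ℝ => a • (G.eAdj w a - (perronRoot (G.weightedAdj w))⁻¹ • G.weightedAdj w))
      atTop (𝓝 (-(perronRoot (G.weightedAdj w))⁻¹ • G.multiplicityMatrix)) := by
  classical
  set ρ := perronRoot (G.weightedAdj w) with hρ
  refine tendsto_pi_nhds.2 fun i => tendsto_pi_nhds.2 fun j => ?_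
  have hlim : (-ρ⁻¹ • G.multiplicityMatrix) i j =
      ∑ e : E(G), if G.IsLink (e : β) (i : α) (j : α) then -ρ⁻¹ else 0 := by
    simp [multiplicityMatrix, ← Finset.sum_filter, mul_comm]
  have hfun : ∀ a : ℝ, (a • (G.eAdj w a - ρ⁻¹ • G.weightedAdj w)) i j =
      ∑ e : E(G), if G.IsLink (e : β) (i : α) (j : α) then
        w e * ρ⁻¹ * (a * (Real.exp (-(1 / (a * w e))) - 1)) else 0 := fun a => by
    simp only [eAdj, Matrix.smul_apply, Matrix.sub_apply, smul_eq_mul]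
    simp only [weightedAdj, Matrix.of_apply, Finset.mul_sum, ← Finset.sum_sub_distrib]
    refine Finset.sum_congr rfl fun e _ => ?_
    split_ifs
    · rw [eWeight, ← hρ]
      ring
    · simp
  simp only [hlim, hfun]
  refine tendsto_finsetSum _ fun e _ => ?_
  split_ifs
  · have := (tendsto_mul_exp_sub_one (x := w e)).const_mul (w e * ρ⁻¹)
    convert this using 2
    have := (hw e e.2).ne'
    field_simp
  · exact tendsto_const_nhds

/-- The column asymptotics are applied with `q = p / p j`. The derivative `p j / p i` of the
logarithm replaces `(p j)⁻¹` by `(p i)⁻¹`, and the powers of `ρ` from `I - A/ρ` and from the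
perturbation cancel. -/
theorem tendsto_mul_log_div_eWalkWeights (hV : 1 < Fintype.card V(G)) (hG : G.WalkConnected)
    (hw : ∀ e ∈ E(G), 0 < w e) {p : V(G) → ℝ} (hp : IsPerronVector (G.weightedAdj w) p)
    (i j : V(G)) (hij : i ≠ j) :
    Tendsto (fun a : ℝ => a * (Real.log (G.eWalkWeights w a i j / G.eWalkWeights w a j j) -
        Real.log (p i / p j))) atTop
      (𝓝 (-((p i)⁻¹ * (((removeRowCol (paraLaplacian (G.weightedAdj w)) j)⁻¹ *
        removeRow G.multiplicityMatrix j) *ᵥ p) ⟨i, hij⟩))) := by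
  have := Fintype.one_lt_card_iff_nontrivial.1 hV
  have hn := weightedAdj_nonneg (G := G) fun e he => (hw e he).le
  have hi := exists_weightedAdj_pow_pos hG hw
  have hs := weightedAdj_isHermitian (G := G) w
  have hpp := hp.pos hn hi
  have hρ := perronRoot_weightedAdj_pos hV hG hw
  have hu := isUnit_det_removeRowCol_paraLaplacian hs hn hi j
  set A := G.weightedAdj w
  set ρ := perronRoot A
  have hone : 1 - ρ⁻¹ • A = ρ⁻¹ • paraLaplacian A := by
    rw [paraLaplacian, smul_sub, inv_smul_smul₀ hρ.ne']
  have hrem : removeRowCol (1 - ρ⁻¹ • A) j = ρ⁻¹ • removeRowCol (paraLaplacian A) j := by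
    rw [hone]
    rfl
  have hu' : IsUnit (removeRowCol (1 - ρ⁻¹ • A) j).det := by
    rw [hrem, Matrix.det_smul, IsUnit.mul_iff]
    exact ⟨(isUnit_iff_ne_zero.2 (inv_ne_zero hρ.ne')).pow _, hu⟩
  have h := tendsto_mul_div_sub (B := G.eAdj w) (R := G.eWalkWeights w) (q := (p j)⁻¹ • p)
    (j := j) ?_ ?_ (tendsto_smul_eAdj_sub hw) ?_ (by simp [(hpp j).ne']) hu' ⟨i, hij⟩
  · have hq : ((p j)⁻¹ • p) i = p i / p j := by simp [div_eq_inv_mul]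
    have h2 := tendsto_mul_sub_comp
      (Real.hasDerivAt_log (div_pos (hpp i) (hpp j)).ne') (hq ▸ h)
    convert h2 using 2
    have hinv : (ρ⁻¹ • removeRowCol (paraLaplacian A) j)⁻¹ =
        ρ • (removeRowCol (paraLaplacian A) j)⁻¹ := by
      refine Matrix.inv_eq_left_inv ?_
      rw [Matrix.smul_mul, Matrix.mul_smul, smul_smul, mul_inv_cancel₀ hρ.ne', one_smul,
        Matrix.nonsing_inv_mul _ hu]
    have hrow : removeRow (-ρ⁻¹ • G.multiplicityMatrix) j =
        -ρ⁻¹ • removeRow G.multiplicityMatrix j := rfl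
    rw [hrem, hinv, hrow, Matrix.smul_mul, Matrix.mul_smul, smul_smul, mul_neg,
      mul_inv_cancel₀ hρ.ne', Matrix.mulVec_smul, neg_one_smul, Matrix.neg_mulVec]
    simp only [Pi.smul_apply, Pi.neg_apply, smul_eq_mul]
    have := (hpp i).ne'
    have := (hpp j).ne'
    field_simp
  · filter_upwards [eventually_gt_atTop 0] with a ha
    exact one_sub_mul_tsum_pow (summable_eAdj_pow hV hG hw ha)
  · filter_upwards [eventually_gt_atTop 0] with a ha
    exact (eWalkWeights_pos hV hG hw ha j j).ne'
  · rw [Matrix.mulVec_smul, Matrix.smul_mulVec, hp.1, inv_smul_smul₀ hρ.ne']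

theorem tendsto_eWalkDist_atTop (hV : 1 < Fintype.card V(G)) (hG : G.WalkConnected)
    (hw : ∀ e ∈ E(G), 0 < w e) {θ : ℝ → ℝ} {θinf : ℝ} (hθ : Tendsto θ atTop (𝓝 θinf))
    {p : V(G) → ℝ} (hp : IsPerronVector (G.weightedAdj w) p) (i j : V(G)) (hij : i ≠ j) :
    Tendsto (fun a : ℝ => G.eWalkDist w θ a i j) atTop
      (𝓝 (longEWalkValue (G.weightedAdj w) G.multiplicityMatrix p θinf i j hij)) := by
  have hpp := hp.pos (weightedAdj_nonneg (G := G) fun e he => (hw e he).le)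
    (exists_weightedAdj_pow_pos hG hw)
  have h := hθ.mul (((tendsto_mul_log_div_eWalkWeights hV hG hw hp i j hij).add
    (tendsto_mul_log_div_eWalkWeights hV hG hw hp j i hij.symm)).const_mul (-(1 / 2)))
  have hval : longEWalkValue (G.weightedAdj w) G.multiplicityMatrix p θinf i j hij =
      θinf * (-(1 / 2) * (-((p i)⁻¹ * (((removeRowCol (paraLaplacian (G.weightedAdj w)) j)⁻¹ *
        removeRow G.multiplicityMatrix j) *ᵥ p) ⟨i, hij⟩) +
        -((p j)⁻¹ * (((removeRowCol (paraLaplacian (G.weightedAdj w)) i)⁻¹ *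
        removeRow G.multiplicityMatrix i) *ᵥ p) ⟨j, hij.symm⟩))) := by
    rw [longEWalkValue, add_dotProduct, smul_dotProduct, smul_dotProduct]
    simp only [Matrix.mulVec, smul_eq_mul]
    ring
  rw [hval]
  refine h.congr' ?_
  filter_upwards [eventually_gt_atTop 0] with a ha
  have hr := fun i j => (eWalkWeights_pos hV hG hw ha i j).ne'
  rw [eWalkDist_eq, Real.log_div (hr i j) (hr j j), Real.log_div (hr j i) (hr i i),
    Real.log_div (hpp i).ne' (hpp j).ne', Real.log_div (hpp j).ne' (hpp i).ne',
    eWalkWeights_symm hV hG hw ha j i]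
  ring

end LongWalks

end Graph

theorem mainTheorem7 {α β : Type*} [DecidableEq α] (G : Graph α β) [Fintype V(G)] [Fintype E(G)]
    (hV : 1 < Fintype.card V(G)) (hG : G.WalkConnected)
    (w : β → ℝ) (hw : ∀ e ∈ E(G), 0 < w e)
    (θ : ℝ → ℝ) (θinf : ℝ) (hθ : ∀ a : ℝ, 0 < a → 0 < θ a)
    (hθ_zero : Tendsto θ (𝓝[>] 0) (𝓝 1)) (hθ_inf : Tendsto θ atTop (𝓝 θinf)) :
    -- the objects in the two limit relations are well defined
    (∀ a : ℝ, 0 < a → Summable (fun k : ℕ => G.eAdj w a ^ k) ∧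
      ∀ i j : V(G), 0 < G.eWalkWeights w a i j) ∧
    (∀ i j : V(G), IsLeast (G.pathLengths w i j) (G.weightedShortestPathDist w i j)) ∧
    (∃! p : V(G) → ℝ, Graph.IsPerronVector (G.weightedAdj w) p) ∧
    (∀ p : V(G) → ℝ, Graph.IsPerronVector (G.weightedAdj w) p → ∀ i, 0 < p i) ∧
    (∀ j : V(G),
      IsUnit (Graph.removeRowCol (Graph.paraLaplacian (G.weightedAdj w)) j).det) ∧
    -- the limit relations
    ∀ (i j : V(G)) (hij : i ≠ j),
      Tendsto (fun a : ℝ => G.eWalkDist w θ a i j) (𝓝[>] 0)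
        (𝓝 (G.weightedShortestPathDist w i j)) ∧
      ∀ p : V(G) → ℝ, Graph.IsPerronVector (G.weightedAdj w) p →
        Tendsto (fun a : ℝ => G.eWalkDist w θ a i j) atTop
          (𝓝 (Graph.longEWalkValue (G.weightedAdj w) G.multiplicityMatrix p θinf i j hij)) ∧
        (G.NoParallelEdges →
          Tendsto (fun a : ℝ => G.eWalkDist w θ a i j) atTop
            (𝓝 (Graph.longEWalkValue (G.weightedAdj w)
              (Graph.supportMatrix (G.weightedAdj w)) p θinf i j hij))) := by
  have := Fintype.one_lt_card_iff_nontrivial.1 hV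
  have hn := Graph.weightedAdj_nonneg (G := G) fun e he => (hw e he).le
  have hi := Graph.exists_weightedAdj_pow_pos hG hw
  have hs := Graph.weightedAdj_isHermitian (G := G) w
  refine ⟨fun a ha => ⟨Graph.summable_eAdj_pow hV hG hw ha, Graph.eWalkWeights_pos hV hG hw ha⟩,
    Graph.isLeast_weightedShortestPathDist hG hw, Graph.existsUnique_isPerronVector hs hn hi,
    fun p hp => hp.pos hn hi, Graph.isUnit_det_removeRowCol_paraLaplacian hs hn hi,
    fun i j hij => ⟨Graph.tendsto_eWalkDist_nhdsGT_zero hV hG hw hθ_zero i j, fun p hp => ?_⟩⟩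
  have h := Graph.tendsto_eWalkDist_atTop hV hG hw hθ_inf hp i j hij
  exact ⟨h, fun hN => hN.multiplicityMatrix_eq hw ▸ h⟩
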